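/- Let $n \ge 0$ and let $k_1,\dots,k_n \in \{-1,0,1\}$ be characteristics. Put $K_i = k_1\cdots k_i$ ($K_0=1$) and $x\odot y=\sum_{i=0}^n K_i x_i y_i$ for $x,y\in\mathbb{R}^{n+1}$. Let $\Sigma=\{x\in\mathbb{R}^{n+1} : x\odot x=1\}$ and let $\mathbb{B}^n\subset P\mathbb{R}^n$ be the set of points of projective space that have a representative in $\Sigma$ (which is then unique up to sign). A real $(n+1)\times(n+1)$ matrix with columns $c_0,\dots,c_n$ is generalized orthogonal if $\frac{1}{K_{\min(i,j)}}\,c_i\odot c_j=\delta_{ij}$ for all $i,j$. If some characteristics vanish, the division is formal: the entries $a_{li}$ with $l<i$ and $k_{l+1}\cdots k_i=0$ must be $0$, and for $i\le j$ the quotient is $\sum_l \kappa_{il}\,a_{li}a_{lj}$, where $\kappa_{il}=\prod_{\min(i,l)<p\le\max(i,l)}k_p$. At $x\in\Sigma$, the native volume of the parallelepiped spanned by tangent vectors $v_1,\dots,v_n$ is the absolute value of the determinant of their coordinates in a frame $a_1,\dots,a_n$ for which the matrix with columns $x,a_1,\dots,a_n$ is generalized orthogonal (it does not depend on the frame). The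 native volume $V(P)$ of a patch $P$, that is, of an injectively and immersively $C^1$-parametrized piece $\varphi(A)$ of $\Sigma$ ($\varphi$ defined on an open subset of $\mathbb{R}^n$ containing the Borel set $A$), is the integral over $A$ of the native volume of the parallelepiped spanned by $\partial_1\varphi,\dots,\partial_n\varphi$. The native volume $V_\Sigma(F)$ of $F\subset\Sigma$, or $V_{\mathbb{B}}(G)$ of $G\subset\mathbb{B}^n$, is the infimum of $\sum_i V(P_i)$ over countable families of patches $P_i$ that cover $F$, respectively whose vectors represent all points of $G$. For $F\subset\Sigma$ let $C_F=\{tx : 0\le t\le 1,\ x\in F\}$ be the cone with vertex at the origin and base $F$, and let $V_{\mathbb{R}}$ denote Lebesgue (Euclidean) volume in $\mathbb{R}^{n+1}$. Then: 1. for every Borel set $F\subset\Sigma$, $\ V_{\mathbb{R}}(C_F)=\frac{1}{n+1}\,V_\Sigma(F)$; 2. for every figure $G\subset\mathbb{B}^n$ and every Borel set $F\subset\Sigma$ that consists of exactly one representative of each point of $G$, $\ V_{\mathbb{R}}(C_F)=\frac{1}{n+1}\,V_{\mathbb{B}}(G)$. Both sides may be $+\infty$. -/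

import Mathlib

open scoped ENNReal LinearAlgebra.Projectivization

noncomputable section

/-- `charRatio k a b` is the product of the characteristics `k_p` with `min a b < p ≤ max a b`
(the characteristic `k_p`, `1 ≤ p ≤ n`, is stored at index `p - 1`). For `a ≤ b` this is the
quotient `K_b / K_a`, read formally, so that it also makes sense when characteristics vanish. -/
def charRatio {n : ℕ} (k : Fin n → ℝ) (a b : Fin (n + 1)) : ℝ :=
  ∏ j : Fin n with min a.val b.val ≤ j.val ∧ j.val < max a.val b.val, k j

/-- `K_i = k_1 ⋯ k_i`, with `K_0 = 1`. -/
def charProd {n : ℕ} (k : Fin n → ℝ) (i : Fin (n + 1)) : ℝ :=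
  ∏ j : Fin n with j.val < i.val, k j

/-- The dot product `x ⊙ y = ∑ K_i x_i y_i`. -/
def charDot {n : ℕ} (k : Fin n → ℝ) (x y : Fin (n + 1) → ℝ) : ℝ :=
  ∑ i, charProd k i * x i * y i

/-- The hypersurface of all vectors of `ℝ^{n+1}` with `x ⊙ x = 1`. -/
def unitVectors {n : ℕ} (k : Fin n → ℝ) : Set (Fin (n + 1) → ℝ) :=
  {x | charDot k x x = 1}

/-- The geometric space `𝔹ⁿ`: the points of the projective space `Pℝⁿ` that have a
representative `x` with `x ⊙ x = 1` (such a representative is unique up to sign). -/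
def unitBall {n : ℕ} (k : Fin n → ℝ) : Set (ℙ ℝ (Fin (n + 1) → ℝ)) :=
  {p | ∃ x ∈ p.submodule, x ∈ unitVectors k}

/-- `A` is generalized orthogonal: `(c_i ⊙ c_j) / K_{min(i,j)}` is `1` for `i = j` and `0`
otherwise, where `c_i` are the columns of `A`. The division is the formal one when `K_{min(i,j)}`
vanishes: an entry `A l i` above the diagonal has to be divisible by `K_i / K_l`, that is, it is
`0` when `K_i / K_l` vanishes, and then the term `K_l A_{li} A_{lj} / K_i` of the quotient
(`i ≤ j`) is `(K_l / K_i) A_{li} A_{lj}`; here `K_l / K_i = K_i / K_l` if this is `1` or `-1`. -/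
def IsGenOrthogonal {n : ℕ} (k : Fin n → ℝ) (A : Matrix (Fin (n + 1)) (Fin (n + 1)) ℝ) : Prop :=
  (∀ l i, l < i → charRatio k l i = 0 → A l i = 0) ∧
  ∀ i j, i ≤ j → ∑ l, charRatio k i l * A l i * A l j = if i = j then 1 else 0

/-- The native volume of the parallelepiped spanned by tangent vectors `v_1, …, v_n` at the point
`x`: the absolute value of the determinant of their coordinates `c` in a frame `a_1, …, a_n` of
native unit vectors at `x`, which means that `x, a_1, …, a_n` are the columns of a generalized
orthogonal matrix. The value is the same for all such frames (the infimum is taken over them). -/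
def nativeParallelepipedVolume {n : ℕ} (k : Fin n → ℝ) (x : Fin (n + 1) → ℝ)
    (v : Fin n → Fin (n + 1) → ℝ) : ℝ≥0∞ :=
  ⨅ (A : Matrix (Fin (n + 1)) (Fin (n + 1)) ℝ) (c : Matrix (Fin n) (Fin n) ℝ)
    (_ : IsGenOrthogonal k A) (_ : ∀ l, A l 0 = x l)
    (_ : ∀ j l, v j l = ∑ i, c i j * A l i.succ), ENNReal.ofReal |c.det|

/-- A parametrized patch of the hypersurface `x ⊙ x = 1`: an injective `C¹` immersion `param` of
an open set `U ⊆ ℝⁿ`, together with a Borel set `A ⊆ U` of parameters. -/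
structure NativePatch {n : ℕ} (k : Fin n → ℝ) where
  param : (Fin n → ℝ) → (Fin (n + 1) → ℝ)
  U : Set (Fin n → ℝ)
  isOpen_U : IsOpen U
  contDiffOn : ContDiffOn ℝ 1 param U
  injOn : Set.InjOn param U
  immersion : ∀ u ∈ U, Function.Injective (fderiv ℝ param u)
  mapsTo : Set.MapsTo param U (unitVectors k)
  A : Set (Fin n → ℝ)
  measurableSet_A : MeasurableSet A
  subset_U : A ⊆ U

/-- The part of the hypersurface that a patch parametrizes. -/
def NativePatch.image {n : ℕ} {k : Fin n → ℝ} (P : NativePatch k) : Set (Fin (n + 1) → ℝ) :=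
  P.param '' P.A

/-- The native volume of a patch, by integration of the native volume element. -/
def NativePatch.vol {n : ℕ} {k : Fin n → ℝ} (P : NativePatch k) : ℝ≥0∞ :=
  ∫⁻ u in P.A, nativeParallelepipedVolume k (P.param u)
    (fun i => fderiv ℝ P.param u (Pi.single i 1))

/-- The native volume of a set `F` of vectors with `x ⊙ x = 1`: the infimum of the total native
volume of countable families of patches that cover `F`. -/
def nativeVolumeVec {n : ℕ} (k : Fin n → ℝ) (F : Set (Fin (n + 1) → ℝ)) : ℝ≥0∞ :=
  ⨅ (P : ℕ → NativePatch k) (_ : F ⊆ ⋃ i, (P i).image), ∑' i, (P i).vol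

/-- The native volume of a figure `G ⊆ 𝔹ⁿ`: the infimum of the total native volume of countable
families of patches that cover `G`, a patch covering the points that its vectors represent. -/
def nativeVolume {n : ℕ} (k : Fin n → ℝ) (G : Set (ℙ ℝ (Fin (n + 1) → ℝ))) : ℝ≥0∞ :=
  ⨅ (P : ℕ → NativePatch k) (_ : ∀ p ∈ G, ∃ i, ∃ x ∈ (P i).image, x ∈ p.submodule),
    ∑' i, (P i).vol

/-- `F` is the figure `G ⊆ 𝔹ⁿ` placed in `ℝ^{n+1}`: a set of vectors with `x ⊙ x = 1` that
contains exactly one representative of each point of `G`, and no other vectors. -/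
def Represents {n : ℕ} (k : Fin n → ℝ) (F : Set (Fin (n + 1) → ℝ))
    (G : Set (ℙ ℝ (Fin (n + 1) → ℝ))) : Prop :=
  F ⊆ unitVectors k ∧ (∀ x ∈ F, ∃ p ∈ G, x ∈ p.submodule) ∧
    ∀ p ∈ G, ∃! x, x ∈ F ∧ x ∈ p.submodule

/-- The cone with vertex at the origin and base `F`. -/
def coneOver {n : ℕ} (F : Set (Fin (n + 1) → ℝ)) : Set (Fin (n + 1) → ℝ) :=
  {y | ∃ t ∈ Set.Icc (0 : ℝ) 1, ∃ x ∈ F, y = t • x}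

end

/-!
The cone over a patch `φ(A)` is parametrized by `(t, u) ↦ t φ(u)` with `0 < t ≤ 1`, whose Jacobian
determinant is `t ^ n det(φ, ∂_1 φ, …, ∂_n φ)`. The native volume element of the patch is the absolute
value of `det(φ, ∂_1 φ, …, ∂_n φ)`, because a frame at `x` is a matrix with first column `x` and with
determinant `±1` (`IsGenOrthogonal.abs_det`, `nativeParallelepipedVolume_eq`); frames exist, being
given by reflections (`exists_isGenOrthogonal`), so that the infimum in the definition is attained.
Since `∫ t ^ n = 1 / (n + 1)`, the formula holds for patches (`NativePatch.coneMeasure_image`).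

The Euclidean volume of the cone over `F` is a measure as a function of `F` (`coneMeasure`). By
subadditivity, `n + 1` times this measure is at most the total native volume of any countable cover of
`F` by patches, and equality holds for a partition of `F` into patches (`exists_patch_partition`),
which comes from the charts in which one coordinate is a square root of a function of the others.

For figures in projective space a patch `S` may cover a point by either of its two representatives,
so that `F` is covered by the sets `S ∪ -S`. The cone measure is invariant under `x ↦ -x`, and `F` is
disjoint from `-F`, so the part of `F` in `S ∪ -S` has at most the cone measure of `S`
(`coneMeasure_inter_union_neg_le`), and the same two inequalities hold.
-/

/-! ### Formal quotients of characteristics -/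

/-- The number of vanishing characteristics among `k_1, …, k_i`. Two indices lie in the same diagonal
block of generalized orthogonal matrices when their values agree. -/
noncomputable def zeroCount {n : ℕ} (k : Fin n → ℝ) (i : Fin (n + 1)) : ℕ :=
  Finset.card {j : Fin n | j.val < i.val ∧ k j = 0}

/-- The product `k_1 ⋯ k_i` with the vanishing factors left out; it is `1` or `-1`. -/
noncomputable def charSign {n : ℕ} (k : Fin n → ℝ) (i : Fin (n + 1)) : ℝ :=
  ∏ j : Fin n with j.val < i.val, if k j = 0 then 1 else k j

theorem charRatio_comm {n : ℕ} (k : Fin n → ℝ) (a b : Fin (n + 1)) :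
    charRatio k a b = charRatio k b a := by
  simp only [charRatio, min_comm, max_comm]

theorem charProd_eq_charRatio {n : ℕ} (k : Fin n → ℝ) (i : Fin (n + 1)) :
    charProd k i = charRatio k 0 i := by
  simp [charRatio, charProd]

theorem zeroCount_zero {n : ℕ} (k : Fin n → ℝ) : zeroCount k 0 = 0 := by
  simp [zeroCount]

theorem charSign_zero {n : ℕ} (k : Fin n → ℝ) : charSign k 0 = 1 := by
  simp [charSign]

theorem charProd_zero {n : ℕ} (k : Fin n → ℝ) : charProd k 0 = 1 := by
  simp [charProd]

theorem zeroCount_mono {n : ℕ} (k : Fin n → ℝ) : Monotone (zeroCount k) := by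
  intro a b hab
  refine Finset.card_le_card fun j hj => ?_
  simp only [Finset.mem_filter, Finset.mem_univ, true_and] at hj ⊢
  exact ⟨hj.1.trans_le hab, hj.2⟩

theorem charSign_mul_self {n : ℕ} {k : Fin n → ℝ} (hk : ∀ i, k i = -1 ∨ k i = 0 ∨ k i = 1)
    (i : Fin (n + 1)) : charSign k i * charSign k i = 1 := by
  rw [charSign, ← Finset.prod_mul_distrib]
  refine Finset.prod_eq_one fun j _ => ?_
  rcases hk j with h | h | h <;> simp [h]

/-- The formal quotient `K_b / K_a` is a product of two signs inside a diagonal block and vanishes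
between different blocks. -/
theorem charRatio_eq {n : ℕ} {k : Fin n → ℝ} (hk : ∀ i, k i = -1 ∨ k i = 0 ∨ k i = 1)
    (a b : Fin (n + 1)) :
    charRatio k a b =
      if zeroCount k a = zeroCount k b then charSign k a * charSign k b else 0 := by
  wlog hab : a ≤ b generalizing a b
  · rw [charRatio_comm, this b a (le_of_not_ge hab), mul_comm]
    simp only [eq_comm]
  have hab' : a.val ≤ b.val := hab
  split_ifs with h
  · have hsub : Finset.filter (fun j : Fin n => j.val < a.val ∧ k j = 0) Finset.univ =
        Finset.filter (fun j : Fin n => j.val < b.val ∧ k j = 0) Finset.univ := by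
      refine Finset.eq_of_subset_of_card_le (fun j hj => ?_) h.ge
      simp only [Finset.mem_filter, Finset.mem_univ, true_and] at hj ⊢
      exact ⟨hj.1.trans_le hab, hj.2⟩
    have hsplit : charSign k b = charSign k a * charRatio k a b := by
      unfold charSign charRatio
      rw [Finset.prod_filter, Finset.prod_filter, Finset.prod_filter, ← Finset.prod_mul_distrib]
      refine Finset.prod_congr rfl fun j _ => ?_
      have hj := Finset.ext_iff.1 hsub j
      simp only [Finset.mem_filter, Finset.mem_univ, true_and] at hj
      rw [min_eq_left hab', max_eq_right hab']
      by_cases h1 : j.val < a.val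
      · have h2 : j.val < b.val := h1.trans_le hab'
        simp [h1, h2]
      · by_cases h2 : j.val < b.val
        · have h3 : k j ≠ 0 := fun h3 => h1 (hj.2 ⟨h2, h3⟩).1
          simp [h1, h2, h3, not_lt.1 h1]
        · simp [h1, h2]
    rw [hsplit, ← mul_assoc, charSign_mul_self hk, one_mul]
  · have : ∃ j : Fin n, (a.val ≤ j.val ∧ j.val < b.val) ∧ k j = 0 := by
      by_contra! hcon
      refine h (congrArg Finset.card (Finset.ext fun j => ?_))
      simp only [Finset.mem_filter, Finset.mem_univ, true_and]
      refine ⟨fun hj => ⟨hj.1.trans_le hab', hj.2⟩, fun hj => ⟨?_, hj.2⟩⟩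
      by_contra h1
      exact hcon j ⟨not_lt.1 h1, hj.1⟩ hj.2
    obtain ⟨j, hj, h0⟩ := this
    refine Finset.prod_eq_zero (i := j) ?_ h0
    simpa [min_eq_left hab', max_eq_right hab'] using hj

theorem charRatio_self {n : ℕ} (k : Fin n → ℝ) (a : Fin (n + 1)) : charRatio k a a = 1 := by
  refine Finset.prod_eq_one fun j hj => ?_
  simp only [min_self, max_self, Finset.mem_filter] at hj
  omega

theorem charProd_eq {n : ℕ} {k : Fin n → ℝ} (hk : ∀ i, k i = -1 ∨ k i = 0 ∨ k i = 1)
    (i : Fin (n + 1)) :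
    charProd k i = if zeroCount k i = 0 then charSign k i else 0 := by
  rw [charProd_eq_charRatio, charRatio_eq hk, zeroCount_zero, charSign_zero, one_mul]
  simp only [eq_comm]

theorem charProd_mul_self {n : ℕ} {k : Fin n → ℝ} (hk : ∀ i, k i = -1 ∨ k i = 0 ∨ k i = 1)
    {i : Fin (n + 1)} (hi : charProd k i ≠ 0) : charProd k i * charProd k i = 1 := by
  rw [charProd_eq hk] at hi ⊢
  split_ifs at hi ⊢ with h
  · exact charSign_mul_self hk i
  · exact absurd rfl hi

/-- In the first block (`K_i ≠ 0`) the formal quotient is `K_i K_l`, also when `K_l = 0`. -/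
theorem charRatio_eq_charProd_mul {n : ℕ} {k : Fin n → ℝ}
    (hk : ∀ i, k i = -1 ∨ k i = 0 ∨ k i = 1) {i : Fin (n + 1)} (hi : charProd k i ≠ 0)
    (l : Fin (n + 1)) : charRatio k i l = charProd k i * charProd k l := by
  rw [charProd_eq hk] at hi
  rw [charRatio_eq hk, charProd_eq hk, charProd_eq hk]
  split_ifs at hi with h
  · simp [h, eq_comm]
  · exact absurd rfl hi

theorem charProd_eq_zero_of_charRatio {n : ℕ} {k : Fin n → ℝ}
    (hk : ∀ i, k i = -1 ∨ k i = 0 ∨ k i = 1) {l i : Fin (n + 1)} (hli : l ≤ i)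
    (h : charRatio k l i = 0) : charProd k i = 0 := by
  by_contra h0
  rw [charRatio_comm, charRatio_eq_charProd_mul hk h0, mul_eq_zero, or_iff_right h0,
    charProd_eq hk] at h
  rw [charProd_eq hk] at h0
  have hm := zeroCount_mono k hli
  split_ifs at h h0 with h1 h2 h2
  · have := charSign_mul_self hk l
    simp [h] at this
  · exact h0 rfl
  · omega
  · exact h0 rfl

/-! ### Determinants of generalized orthogonal matrices -/

/-- A generalized orthogonal matrix `A` has determinant `±1`. It is block lower triangular, and
so only its diagonal blocks contribute to the determinant. The matrix `B i l = (K_l / K_i) A l i`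
is block diagonal, and its blocks are the transposed blocks of `A`, conjugated by signs; hence
`det B = det A`. Generalized orthogonality says that `B * A` is lower triangular with unit diagonal. -/
theorem IsGenOrthogonal.abs_det {n : ℕ} {k : Fin n → ℝ}
    (hk : ∀ i, k i = -1 ∨ k i = 0 ∨ k i = 1) {A : Matrix (Fin (n + 1)) (Fin (n + 1)) ℝ}
    (hA : IsGenOrthogonal k A) : |A.det| = 1 := by
  have hblock : ∀ l i, zeroCount k l < zeroCount k i → A l i = 0 := by
    intro l i h
    have hli : l < i := by
      by_contra hcon
      exact absurd (zeroCount_mono k (not_lt.1 hcon)) (not_le.2 h)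
    refine hA.1 l i hli ?_
    rw [charRatio_eq hk, if_neg h.ne]
  let A' : Matrix (Fin (n + 1)) (Fin (n + 1)) ℝ :=
    Matrix.of fun i l => if zeroCount k i = zeroCount k l then A l i else 0
  have hAt : Matrix.BlockTriangular A.transpose (zeroCount k) := fun i l h => hblock l i h
  have hA' : Matrix.BlockTriangular A' (zeroCount k) := fun i l h => if_neg h.ne'
  have hdet' : A'.det = A.det := by
    rw [← Matrix.det_transpose A, hAt.det, hA'.det]
    refine Finset.prod_congr rfl fun b _ => congrArg Matrix.det ?_
    ext i l
    simp [Matrix.toSquareBlock_def, A', i.2, l.2]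
  let B : Matrix (Fin (n + 1)) (Fin (n + 1)) ℝ := Matrix.of fun i l => charRatio k i l * A l i
  have hB : B = Matrix.diagonal (charSign k) * A' * Matrix.diagonal (charSign k) := by
    ext i l
    simp only [B, A', Matrix.mul_diagonal, Matrix.diagonal_mul, Matrix.of_apply, charRatio_eq hk]
    split_ifs <;> ring
  have hdetB : B.det = A.det := by
    rw [hB, Matrix.det_mul, Matrix.det_mul, hdet', mul_right_comm, ← Matrix.det_mul,
      Matrix.diagonal_mul_diagonal]
    simp [charSign_mul_self hk]
  have hBA : ∀ i j, i ≤ j → (B * A) i j = if i = j then 1 else 0 := hA.2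
  have h1 : (B * A).det = 1 := by
    rw [Matrix.det_of_isLowerTriangular]
    · exact Finset.prod_eq_one fun i _ => by simp [hBA i i le_rfl]
    · intro i j hij
      have hij' : i < j := hij
      simp [hBA i j hij'.le, hij'.ne]
  rw [Matrix.det_mul, hdetB] at h1
  rcases mul_self_eq_one_iff.1 h1 with h | h <;> simp [h]

/-! ### Existence of frames and the native volume element -/

theorem charDot_comm {n : ℕ} (k : Fin n → ℝ) (x y : Fin (n + 1) → ℝ) :
    charDot k x y = charDot k y x :=
  Finset.sum_congr rfl fun i _ => by ring

theorem charDot_add_right {n : ℕ} (k : Fin n → ℝ) (x y z : Fin (n + 1) → ℝ) :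
    charDot k x (y + z) = charDot k x y + charDot k x z := by
  simp only [charDot, ← Finset.sum_add_distrib, Pi.add_apply]
  exact Finset.sum_congr rfl fun i _ => by ring

theorem charDot_smul_right {n : ℕ} (k : Fin n → ℝ) (c : ℝ) (x y : Fin (n + 1) → ℝ) :
    charDot k x (c • y) = c * charDot k x y := by
  simp only [charDot, Finset.mul_sum, Pi.smul_apply, smul_eq_mul]
  exact Finset.sum_congr rfl fun i _ => by ring

theorem charDot_add_left {n : ℕ} (k : Fin n → ℝ) (x y z : Fin (n + 1) → ℝ) :
    charDot k (x + y) z = charDot k x z + charDot k y z := by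
  simp only [charDot_comm k _ z, charDot_add_right]

theorem charDot_smul_left {n : ℕ} (k : Fin n → ℝ) (c : ℝ) (x y : Fin (n + 1) → ℝ) :
    charDot k (c • x) y = c * charDot k x y := by
  simp only [charDot_comm k _ y, charDot_smul_right]

theorem charDot_single_left {n : ℕ} (k : Fin n → ℝ) (i : Fin (n + 1)) (x : Fin (n + 1) → ℝ) :
    charDot k (Pi.single i 1) x = charProd k i * x i := by
  rw [charDot, Finset.sum_eq_single i] <;> simp +contextual

/-- Up to the sign `ε`, the reflection along a vector `u` that is not isotropic, as a matrix on the
standard basis, is generalized orthogonal. If `K_i = 0`, then the image of the `i`-th basis vector is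
`ε` times that vector, so only the first diagonal block is affected, apart from entries of its columns
below that block. -/
theorem isGenOrthogonal_reflection {n : ℕ} {k : Fin n → ℝ}
    (hk : ∀ i, k i = -1 ∨ k i = 0 ∨ k i = 1) {ε : ℝ} (hε : ε * ε = 1) {u : Fin (n + 1) → ℝ}
    (hu : charDot k u u ≠ 0) :
    IsGenOrthogonal k (Matrix.of fun l i =>
      (ε • ((Pi.single i 1 : Fin (n + 1) → ℝ) - (2 * charProd k i * u i / charDot k u u) • u)) l) := by
  set w := fun i => ε • ((Pi.single i 1 : Fin (n + 1) → ℝ) -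
    (2 * charProd k i * u i / charDot k u u) • u) with hw
  have hdeg : ∀ i l, charProd k i = 0 → w i l = ε * if l = i then 1 else 0 := by
    intro i l h
    simp [hw, h, Pi.single_apply]
  refine ⟨fun l i hli h => ?_, fun i j hij => ?_⟩
  · have := hdeg i l (charProd_eq_zero_of_charRatio hk hli.le h)
    rw [if_neg hli.ne, mul_zero] at this
    exact this
  · change ∑ l, charRatio k i l * w i l * w j l = _
    by_cases hi : charProd k i = 0
    · have hj : charProd k j = 0 := by
        rw [charProd_eq hk] at hi ⊢
        rw [if_neg]
        intro h
        have := zeroCount_mono k hij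
        rw [if_pos (by omega)] at hi
        have := charSign_mul_self hk i
        simp [hi] at this
      rw [Finset.sum_eq_single i]
      · rw [hdeg i i hi, hdeg j i hj, charRatio_self]
        simp only [if_true, one_mul, mul_one, mul_ite, mul_zero, hε]
      · intro l _ hl
        simp [hdeg i l hi, hl]
      · simp
    · have h1 : ∑ l, charRatio k i l * w i l * w j l = charProd k i * charDot k (w i) (w j) := by
        rw [charDot, Finset.mul_sum]
        refine Finset.sum_congr rfl fun l _ => ?_
        rw [charRatio_eq_charProd_mul hk hi]
        ring
      have h2 : charDot k (w i) (w j) = charProd k i * if i = j then 1 else 0 := by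
        simp only [hw]
        rw [charDot_smul_left, charDot_smul_right, ← mul_assoc, hε, one_mul]
        simp only [charDot_smul_left, charDot_smul_right, sub_eq_add_neg, ← neg_smul,
          charDot_add_left, charDot_add_right, charDot_single_left]
        rw [charDot_comm k u (Pi.single j 1), charDot_single_left, Pi.single_apply]
        field_simp
        ring
      rw [h1, h2, ← mul_assoc, charProd_mul_self hk hi, one_mul]

/-- There is a frame at every vector with `x ⊙ x = 1`. One of the reflections along `x - e_0` and
`x + e_0`, the latter followed by a change of sign, takes the first basis vector `e_0` to `x`. -/
theorem exists_isGenOrthogonal {n : ℕ} {k : Fin n → ℝ}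
    (hk : ∀ i, k i = -1 ∨ k i = 0 ∨ k i = 1) {x : Fin (n + 1) → ℝ} (hx : x ∈ unitVectors k) :
    ∃ A, IsGenOrthogonal k A ∧ ∀ l, A l 0 = x l := by
  have hx' : charDot k x x = 1 := hx
  set e : Fin (n + 1) → ℝ := Pi.single 0 1
  have hex : charDot k e x = x 0 := by simp [e, charDot_single_left, charProd_zero]
  have hxe : charDot k x e = x 0 := by rw [charDot_comm, hex]
  have hee : charDot k e e = 1 := by simp [e, charDot_single_left, charProd_zero]
  have huu : ∀ ε : ℝ, ε * ε = 1 → charDot k (x + (-ε) • e) (x + (-ε) • e) = 2 - 2 * ε * x 0 := by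
    intro ε hε
    simp only [charDot_add_left, charDot_add_right, charDot_smul_left, charDot_smul_right, hx',
      hex, hxe, hee]
    linear_combination hε
  obtain ⟨ε, hε, h0⟩ : ∃ ε : ℝ, ε * ε = 1 ∧ (2 - 2 * ε * x 0) ≠ 0 := by
    by_cases h : x 0 = 1
    · exact ⟨-1, by norm_num, by rw [h]; norm_num⟩
    · exact ⟨1, by norm_num, fun h' => h (by linarith)⟩
  -- The reflection along `x - ε e`, times `ε`, takes `e` to `x`.
  refine ⟨_, isGenOrthogonal_reflection hk hε (u := x + (-ε) • e) (by rwa [huu ε hε]), fun l => ?_⟩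
  have h2 : 2 * charProd k 0 * (x + -ε • e) 0 / (2 - 2 * ε * x 0) = -ε := by
    rw [div_eq_iff h0, charProd_zero]
    simp [e]
    linear_combination -2 * x 0 * hε
  rw [Matrix.of_apply, huu ε hε, h2]
  simp only [Pi.smul_apply, Pi.sub_apply, Pi.add_apply, smul_eq_mul]
  linear_combination (x l - ε * e l) * hε

/-- The native volume of the parallelepiped spanned by tangent vectors at `x` is the Euclidean volume
of the parallelepiped spanned by `x` and these vectors, since frames have determinant `±1`. -/
theorem nativeParallelepipedVolume_eq {n : ℕ} {k : Fin n → ℝ}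
    (hk : ∀ i, k i = -1 ∨ k i = 0 ∨ k i = 1) {x : Fin (n + 1) → ℝ} (hx : x ∈ unitVectors k)
    {v : Fin n → Fin (n + 1) → ℝ} (hv : ∀ j, charDot k x (v j) = 0) :
    nativeParallelepipedVolume k x v =
      ENNReal.ofReal |(Matrix.of (Matrix.vecCons x v)).det| := by
  have key : ∀ (A : Matrix (Fin (n + 1)) (Fin (n + 1)) ℝ) (c : Matrix (Fin n) (Fin n) ℝ),
      IsGenOrthogonal k A → (∀ l, A l 0 = x l) →
      (∀ j l, v j l = ∑ i, c i j * A l i.succ) →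
      |c.det| = |(Matrix.of (Matrix.vecCons x v)).det| := by
    intro A c hA h0 hc
    -- `C` is the block diagonal matrix of `1` and `c`, the coordinates of `x` and `v` in the frame.
    let C : Matrix (Fin (n + 1)) (Fin (n + 1)) ℝ :=
      (Matrix.of (Matrix.vecCons (Pi.single 0 1) fun j =>
        Matrix.vecCons 0 fun i => c i j)).transpose
    have hC : C.det = c.det := by
      rw [Matrix.det_succ_column_zero, Finset.sum_eq_single 0]
      · have : C.submatrix (Fin.succAbove 0) Fin.succ = c := by
          ext i j
          simp [C]
        rw [this]
        simp [C]
      · intro i _ hi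
        obtain ⟨i, rfl⟩ := Fin.exists_succ_eq.2 hi
        simp [C]
      · simp
    have hAC : (Matrix.of (Matrix.vecCons x v)).transpose = A * C := by
      ext l j
      rw [Matrix.mul_apply, Fin.sum_univ_succ]
      cases j using Fin.cases with
      | zero => simp [C, h0]
      | succ j => simp [C, hc, mul_comm]
    rw [← Matrix.det_transpose (Matrix.of _), hAC, Matrix.det_mul, abs_mul, hA.abs_det hk, one_mul, hC]
  refine le_antisymm ?_ ?_
  · obtain ⟨A, hA, h0⟩ := exists_isGenOrthogonal hk hx
    have hdet : IsUnit A.det := by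
      have := hA.abs_det hk
      exact isUnit_iff_ne_zero.2 fun h => by simp [h] at this
    have hmul : ∀ j l, v j l = ∑ i, A l i * (A⁻¹.mulVec (v j)) i := by
      intro j l
      have : A.mulVec (A⁻¹.mulVec (v j)) = v j := by
        rw [Matrix.mulVec_mulVec, Matrix.mul_nonsing_inv _ hdet, Matrix.one_mulVec]
      exact (congrFun this l).symm
    -- The coordinate along `x` of a tangent vector is its product with `x`, hence `0`.
    have hcoef : ∀ j, (A⁻¹.mulVec (v j)) 0 = 0 := by
      intro j
      have h := hv j
      have hcol : ∀ i, ∑ l, charProd k l * x l * A l i = if 0 = i then 1 else 0 := by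
        intro i
        rw [← hA.2 0 i (Fin.zero_le _)]
        simp only [charProd_eq_charRatio, h0]
      simp only [charDot] at h
      simp_rw [hmul j, Finset.mul_sum] at h
      rw [Finset.sum_comm] at h
      simp_rw [← mul_assoc, ← Finset.sum_mul, hcol] at h
      simpa using h
    have hc : ∀ j l, v j l =
        ∑ i, (Matrix.of fun i j => (A⁻¹.mulVec (v j)) (Fin.succ i)) i j * A l i.succ := by
      intro j l
      rw [hmul j l, Fin.sum_univ_succ, hcoef, mul_zero, zero_add]
      exact Finset.sum_congr rfl fun i _ => mul_comm _ _
    rw [← key A _ hA h0 hc]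
    exact iInf_le_of_le A (iInf_le_of_le _ (iInf_le_of_le hA (iInf_le_of_le h0 (iInf_le _ hc))))
  · refine le_iInf fun A => le_iInf fun c => le_iInf fun hA => le_iInf fun h0 => le_iInf fun hc => ?_
    rw [key A c hA h0 hc]

/-! ### The cone measure -/

theorem charDot_smul_smul {n : ℕ} (k : Fin n → ℝ) (c : ℝ) (x : Fin (n + 1) → ℝ) :
    charDot k (c • x) (c • x) = c ^ 2 * charDot k x x := by
  rw [charDot_smul_left, charDot_smul_right]
  ring

theorem measurable_charDot_self {n : ℕ} (k : Fin n → ℝ) :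
    Measurable fun x : Fin (n + 1) → ℝ => charDot k x x := by
  unfold charDot
  fun_prop

/-- The radial projection `x ↦ x / √(x ⊙ x)` to the hypersurface `x ⊙ x = 1`, meaningful where
`0 < x ⊙ x` (elsewhere it has the value `0`). -/
noncomputable def radialProj {n : ℕ} (k : Fin n → ℝ) (x : Fin (n + 1) → ℝ) : Fin (n + 1) → ℝ :=
  (√(charDot k x x))⁻¹ • x

theorem measurable_radialProj {n : ℕ} (k : Fin n → ℝ) : Measurable (radialProj k) :=
  (measurable_charDot_self k).sqrt.inv.smul measurable_id

theorem radialProj_neg {n : ℕ} (k : Fin n → ℝ) (x : Fin (n + 1) → ℝ) :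
    radialProj k (-x) = -radialProj k x := by
  simp [radialProj, charDot]

theorem radialProj_smul {n : ℕ} {k : Fin n → ℝ} {t : ℝ} (ht : 0 < t) {x : Fin (n + 1) → ℝ}
    (hx : x ∈ unitVectors k) : radialProj k (t • x) = x := by
  have hx' : charDot k x x = 1 := hx
  rw [radialProj, charDot_smul_smul, hx', mul_one, Real.sqrt_sq ht.le, smul_smul,
    inv_mul_cancel₀ ht.ne', one_smul]

/-- The measure on the hypersurface `x ⊙ x = 1` that assigns to a Borel subset of it the
Euclidean volume of the cone over that subset: Lebesgue measure on `0 < x ⊙ x ≤ 1`, pushed forward by the radial projection. -/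
noncomputable def coneMeasure {n : ℕ} (k : Fin n → ℝ) : MeasureTheory.Measure (Fin (n + 1) → ℝ) :=
  (MeasureTheory.volume.restrict {x | 0 < charDot k x x ∧ charDot k x x ≤ 1}).map (radialProj k)

theorem coneMeasure_apply {n : ℕ} (k : Fin n → ℝ) {F : Set (Fin (n + 1) → ℝ)}
    (hF : MeasurableSet F) :
    coneMeasure k F = MeasureTheory.volume
      (radialProj k ⁻¹' F ∩ {x | 0 < charDot k x x ∧ charDot k x x ≤ 1}) := by
  rw [coneMeasure, MeasureTheory.Measure.map_apply (measurable_radialProj k) hF,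
    MeasureTheory.Measure.restrict_apply (measurable_radialProj k hF)]

theorem volume_coneOver {n : ℕ} {k : Fin n → ℝ} {F : Set (Fin (n + 1) → ℝ)}
    (hFk : F ⊆ unitVectors k) (hF : MeasurableSet F) :
    MeasureTheory.volume (coneOver F) = coneMeasure k F := by
  rw [coneMeasure_apply k hF]
  refine le_antisymm ?_ (MeasureTheory.measure_mono ?_)
  · rw [← MeasureTheory.measure_sdiff_null
      (MeasureTheory.measure_singleton (0 : Fin (n + 1) → ℝ))]
    refine MeasureTheory.measure_mono ?_
    rintro _ ⟨⟨t, ht, x, hx, rfl⟩, h0⟩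
    have ht0 : 0 < t := ht.1.lt_of_ne fun h => h0 (by simp [← h])
    have hx' : charDot k x x = 1 := hFk hx
    refine ⟨?_, ?_⟩
    · rwa [Set.mem_preimage, radialProj_smul ht0 (hFk hx)]
    · simp only [Set.mem_ofPred_eq, charDot_smul_smul, hx', mul_one]
      exact ⟨by positivity, pow_le_one₀ ht.1 ht.2⟩
  · rintro x ⟨hx, h0, h1⟩
    refine ⟨√(charDot k x x), ⟨Real.sqrt_nonneg _, Real.sqrt_le_one.2 h1⟩, _, hx, ?_⟩
    rw [radialProj, smul_smul, mul_inv_cancel₀ (Real.sqrt_pos.2 h0).ne', one_smul]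

theorem coneMeasure_neg {n : ℕ} (k : Fin n → ℝ) {F : Set (Fin (n + 1) → ℝ)}
    (hF : MeasurableSet F) : coneMeasure k (-F) = coneMeasure k F := by
  rw [coneMeasure_apply k hF.neg, coneMeasure_apply k hF, ← MeasureTheory.Measure.measure_neg]
  congr 1
  ext x
  simp [radialProj_neg, charDot]

/-! ### Change of variables in a cone -/

/-- The volume of a parametrized cone `t φ(u)`, `0 < t ≤ 1`: the Jacobian determinant of
`(t, u) ↦ t φ(u)` is `t ^ n det(φ, ∂_1 φ, …, ∂_n φ)`, and `∫ t ^ n = 1 / (n + 1)`. The first coordinate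
of a vector of `ℝ^{n+1}` plays the part of `t`, the others that of `u`. -/
theorem volume_image_smul_tail {n : ℕ} {φ : (Fin n → ℝ) → Fin (n + 1) → ℝ} {U A : Set (Fin n → ℝ)}
    (hU : IsOpen U) (hφ : ContDiffOn ℝ 1 φ U) (hA : MeasurableSet A) (hAU : A ⊆ U)
    (hinj : Set.InjOn (fun y : Fin (n + 1) → ℝ => y 0 • φ (Fin.tail y))
      {y | y 0 ∈ Set.Ioc (0 : ℝ) 1 ∧ Fin.tail y ∈ A}) :
    MeasureTheory.volume ((fun y : Fin (n + 1) → ℝ => y 0 • φ (Fin.tail y)) ''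
        {y | y 0 ∈ Set.Ioc (0 : ℝ) 1 ∧ Fin.tail y ∈ A}) =
      1 / ((n : ℝ≥0∞) + 1) * ∫⁻ u in A, ENNReal.ofReal
        |(Matrix.of (Matrix.vecCons (φ u) fun i => fderiv ℝ φ u (Pi.single i 1))).det| := by
  set D : (Fin n → ℝ) → ℝ := fun u =>
    (Matrix.of (Matrix.vecCons (φ u) fun i => fderiv ℝ φ u (Pi.single i 1))).det with hD
  let T : (Fin (n + 1) → ℝ) →L[ℝ] (Fin n → ℝ) :=
    ContinuousLinearMap.pi fun i => ContinuousLinearMap.proj i.succ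
  let L : (Fin (n + 1) → ℝ) → (Fin (n + 1) → ℝ) →L[ℝ] (Fin (n + 1) → ℝ) := fun y =>
    y 0 • (fderiv ℝ φ (Fin.tail y)).comp T +
      (ContinuousLinearMap.proj (R := ℝ) (φ := fun _ : Fin (n + 1) => ℝ) 0).smulRight
        (φ (Fin.tail y))
  have hderiv : ∀ y : Fin (n + 1) → ℝ, Fin.tail y ∈ A →
      HasFDerivAt (fun y : Fin (n + 1) → ℝ => y 0 • φ (Fin.tail y)) (L y) y := by
    intro y hy
    have hφy : HasFDerivAt φ (fderiv ℝ φ (Fin.tail y)) (T y) :=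
      ((hφ.contDiffAt (hU.mem_nhds (hAU hy))).differentiableAt one_ne_zero).hasFDerivAt
    exact (ContinuousLinearMap.proj (R := ℝ) (φ := fun _ : Fin (n + 1) => ℝ) 0).hasFDerivAt.smul
      (hφy.comp y T.hasFDerivAt)
  have hdet : ∀ y, (L y).det = y 0 ^ n * D (Fin.tail y) := by
    intro y
    have hrow : (LinearMap.toMatrix' (L y : (Fin (n + 1) → ℝ) →ₗ[ℝ] (Fin (n + 1) → ℝ))).transpose =
        Matrix.of fun i j => (Matrix.vecCons 1 (fun _ => y 0) : Fin (n + 1) → ℝ) i *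
          Matrix.of (Matrix.vecCons (φ (Fin.tail y))
            fun i => fderiv ℝ φ (Fin.tail y) (Pi.single i 1)) i j := by
      ext i j
      cases i using Fin.cases with
      | zero =>
        have hT : T (Pi.single 0 1) = 0 := by
          ext i
          simp [T]
        simp [LinearMap.toMatrix'_apply, L, hT]
      | succ i =>
        have hT : T (Pi.single i.succ 1) = Pi.single i 1 := by
          ext i'
          simp [T, Pi.single_apply]
        simp [LinearMap.toMatrix'_apply, L, hT]
    rw [ContinuousLinearMap.det, ← LinearMap.det_toMatrix', ← Matrix.det_transpose, hrow,
      Matrix.det_mul_column, Fin.prod_univ_succ]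
    simp [hD]
  have hset : {y : Fin (n + 1) → ℝ | y 0 ∈ Set.Ioc (0 : ℝ) 1 ∧ Fin.tail y ∈ A} =
      MeasurableEquiv.piFinSuccAbove (fun _ => ℝ) 0 ⁻¹' (Set.Ioc (0 : ℝ) 1 ×ˢ A) := by
    ext y
    simp [MeasurableEquiv.piFinSuccAbove]
  have hms : MeasurableSet {y : Fin (n + 1) → ℝ | y 0 ∈ Set.Ioc (0 : ℝ) 1 ∧ Fin.tail y ∈ A} := by
    rw [hset]
    exact (MeasurableEquiv.measurable _) (measurableSet_Ioc.prod hA)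
  have hcont : ContinuousOn D U := by
    have h1 := hφ.continuousOn_fderiv_of_isOpen hU le_rfl
    have h2 : ContinuousOn (fun u => Matrix.of (Matrix.vecCons (φ u) fun i =>
        fderiv ℝ φ u (Pi.single i 1))) U := by
      refine continuousOn_pi.2 fun i => ?_
      cases i using Fin.cases with
      | zero => exact hφ.continuousOn
      | succ i => exact h1.clm_apply continuousOn_const
    exact continuous_id.matrix_det.comp_continuousOn h2
  have hmeas : AEMeasurable (fun u => ENNReal.ofReal |D u|) (MeasureTheory.volume.restrict A) :=
    ((hcont.mono hAU).aemeasurable hA).abs.ennreal_ofReal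
  have hpow : ∫⁻ t in Set.Ioc (0 : ℝ) 1, ENNReal.ofReal |t ^ n| = 1 / ((n : ℝ≥0∞) + 1) := by
    rw [← MeasureTheory.ofReal_integral_eq_lintegral_ofReal
      (((continuous_pow n).abs.integrableOn_Icc (a := 0) (b := 1)).mono_set Set.Ioc_subset_Icc_self)
      (Filter.Eventually.of_forall fun t => abs_nonneg _),
      MeasureTheory.setIntegral_congr_fun measurableSet_Ioc
        (fun t (ht : t ∈ Set.Ioc (0 : ℝ) 1) => abs_of_nonneg (pow_nonneg ht.1.le n)),
      ← intervalIntegral.integral_of_le zero_le_one, integral_pow, one_pow, zero_pow n.succ_ne_zero,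
      sub_zero, ENNReal.ofReal_div_of_pos (by positivity), ENNReal.ofReal_one,
      ENNReal.ofReal_add n.cast_nonneg zero_le_one, ENNReal.ofReal_natCast, ENNReal.ofReal_one]
  rw [← MeasureTheory.lintegral_abs_det_fderiv_eq_addHaar_image _ hms
    (fun y hy => (hderiv y hy.2).hasFDerivWithinAt) hinj, ← hpow,
    ← MeasureTheory.lintegral_prod_mul (by fun_prop) hmeas, MeasureTheory.Measure.prod_restrict,
    hset]
  simp only [hdet, abs_mul, ENNReal.ofReal_mul (abs_nonneg _)]
  exact (MeasureTheory.volume_preserving_piFinSuccAbove (fun _ : Fin (n + 1) => ℝ)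
    0).setLIntegral_comp_preimage_emb (MeasurableEquiv.measurableEmbedding _)
      (fun z => ENNReal.ofReal |z.1 ^ n| * ENNReal.ofReal |D z.2|) _

/-! ### Cones over patches -/

namespace NativePatch

theorem continuousOn_A {n : ℕ} {k : Fin n → ℝ} (P : NativePatch k) : ContinuousOn P.param P.A :=
  P.contDiffOn.continuousOn.mono P.subset_U

theorem measurableSet_image {n : ℕ} {k : Fin n → ℝ} (P : NativePatch k) :
    MeasurableSet P.image :=
  P.measurableSet_A.image_of_continuousOn_injOn P.continuousOn_A (P.injOn.mono P.subset_U)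

theorem image_subset {n : ℕ} {k : Fin n → ℝ} (P : NativePatch k) : P.image ⊆ unitVectors k :=
  (P.mapsTo.mono_left P.subset_U).image_subset

/-- The partial derivatives of a patch are tangent to the hypersurface. -/
theorem charDot_fderiv {n : ℕ} {k : Fin n → ℝ} (P : NativePatch k) {u : Fin n → ℝ}
    (hu : u ∈ P.U) (w : Fin n → ℝ) : charDot k (P.param u) (fderiv ℝ P.param u w) = 0 := by
  have hφ : HasFDerivAt P.param (fderiv ℝ P.param u) u :=
    ((P.contDiffOn.contDiffAt (P.isOpen_U.mem_nhds hu)).differentiableAt one_ne_zero).hasFDerivAt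
  have hi := hasFDerivAt_pi'.1 hφ
  have hsum : HasFDerivAt (fun w => charDot k (P.param w) (P.param w)) _ u :=
    HasFDerivAt.fun_sum fun i _ => ((hi i).const_mul (charProd k i)).mul (hi i)
  have hconst : HasFDerivAt (fun w => charDot k (P.param w) (P.param w))
      (0 : (Fin n → ℝ) →L[ℝ] ℝ) u :=
    (hasFDerivAt_const 1 u).congr_of_eventuallyEq
      (Filter.eventually_of_mem (P.isOpen_U.mem_nhds hu) fun w hw => P.mapsTo hw)
  have h := congrArg (fun f : (Fin n → ℝ) →L[ℝ] ℝ => f w) (hsum.unique hconst)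
  simp only [sum_apply, add_apply, smul_apply, ContinuousLinearMap.comp_apply,
    ContinuousLinearMap.proj_apply, smul_eq_mul, zero_apply] at h
  have h2 : 2 * charDot k (P.param u) (fderiv ℝ P.param u w) = 0 := by
    rw [← h, charDot, Finset.mul_sum]
    exact Finset.sum_congr rfl fun i _ => by ring
  simpa using h2

/-- The Euclidean volume of the cone over a patch is `1 / (n + 1)` times the native volume of the
patch. This is the change of variables `(t, u) ↦ t φ(u)`, which is injective because `t` and `φ(u)`
are recovered from `t φ(u)` by `⊙` and by the radial projection. -/
theorem coneMeasure_image {n : ℕ} {k : Fin n → ℝ} (hk : ∀ i, k i = -1 ∨ k i = 0 ∨ k i = 1)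
    (P : NativePatch k) : coneMeasure k P.image = 1 / ((n : ℝ≥0∞) + 1) * P.vol := by
  have hvol : P.vol = ∫⁻ u in P.A, ENNReal.ofReal |(Matrix.of (Matrix.vecCons (P.param u)
      fun i => fderiv ℝ P.param u (Pi.single i 1))).det| :=
    MeasureTheory.setLIntegral_congr_fun P.measurableSet_A fun u hu =>
      nativeParallelepipedVolume_eq hk (P.mapsTo (P.subset_U hu)) fun j =>
        P.charDot_fderiv (P.subset_U hu) _
  have hproj : ∀ y : Fin (n + 1) → ℝ, y 0 ∈ Set.Ioc (0 : ℝ) 1 → Fin.tail y ∈ P.A →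
      radialProj k (y 0 • P.param (Fin.tail y)) = P.param (Fin.tail y) ∧
      charDot k (y 0 • P.param (Fin.tail y)) (y 0 • P.param (Fin.tail y)) = y 0 ^ 2 := by
    intro y h0 hy
    have h1 := P.mapsTo (P.subset_U hy)
    refine ⟨radialProj_smul h0.1 h1, ?_⟩
    rw [charDot_smul_smul, show charDot k _ _ = 1 from h1, mul_one]
  rw [hvol, ← volume_image_smul_tail P.isOpen_U P.contDiffOn P.measurableSet_A P.subset_U,
    coneMeasure_apply k P.measurableSet_image]
  · congr 1
    ext x
    constructor
    · rintro ⟨⟨u, hu, hux⟩, h0, h1⟩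
      refine ⟨Fin.cons (√(charDot k x x)) u,
        ⟨⟨Real.sqrt_pos.2 h0, Real.sqrt_le_one.2 h1⟩, hu⟩, ?_⟩
      simp only [Fin.cons_zero, Fin.tail_cons, hux]
      rw [radialProj, smul_smul, mul_inv_cancel₀ (Real.sqrt_pos.2 h0).ne', one_smul]
    · rintro ⟨y, ⟨h0, hy⟩, rfl⟩
      obtain ⟨hr, hd⟩ := hproj y h0 hy
      refine ⟨⟨_, hy, hr.symm⟩, ?_⟩
      simp only [Set.mem_ofPred_eq, hd]
      exact ⟨pow_pos h0.1 2, pow_le_one₀ h0.1.le h0.2⟩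
  · rintro y ⟨h0, hy⟩ z ⟨h0', hz⟩ hyz
    simp only at hyz
    obtain ⟨hr, hd⟩ := hproj y h0 hy
    obtain ⟨hr', hd'⟩ := hproj z h0' hz
    have htail : Fin.tail y = Fin.tail z :=
      P.injOn (P.subset_U hy) (P.subset_U hz) (by rw [← hr, ← hr', hyz])
    have hhead : y 0 = z 0 := by
      rw [hyz, hd'] at hd
      exact ((pow_left_inj₀ h0'.1.le h0.1.le two_ne_zero).1 hd).symm
    rw [← Fin.cons_self_tail y, ← Fin.cons_self_tail z, htail, hhead]

theorem vol_eq {n : ℕ} {k : Fin n → ℝ} (hk : ∀ i, k i = -1 ∨ k i = 0 ∨ k i = 1)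
    (P : NativePatch k) : P.vol = ((n : ℝ≥0∞) + 1) * coneMeasure k P.image := by
  rw [P.coneMeasure_image hk, ← mul_assoc, one_div, ENNReal.mul_inv_cancel (by simp) (by finiteness),
    one_mul]

/-- The part of a patch that lies in a given Borel set. -/
noncomputable def restrict {n : ℕ} {k : Fin n → ℝ} (P : NativePatch k) (F : Set (Fin (n + 1) → ℝ))
    (hF : MeasurableSet F) : NativePatch k where
  param := P.param
  U := P.U
  isOpen_U := P.isOpen_U
  contDiffOn := P.contDiffOn
  injOn := P.injOn
  immersion := P.immersion
  mapsTo := P.mapsTo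
  A := P.A ∩ P.param ⁻¹' F
  measurableSet_A := by
    rw [← Subtype.image_preimage_coe]
    exact P.measurableSet_A.subtype_image
      ((continuousOn_iff_continuous_domRestrict.1 P.continuousOn_A).measurable hF)
  subset_U := Set.inter_subset_left.trans P.subset_U

theorem image_restrict {n : ℕ} {k : Fin n → ℝ} (P : NativePatch k) {F : Set (Fin (n + 1) → ℝ)}
    (hF : MeasurableSet F) : (P.restrict F hF).image = P.image ∩ F :=
  Set.image_inter_preimage _ _ _

end NativePatch

/-! ### Graph charts of the hypersurface -/

/-- The value of `x_i²` on the hypersurface `x ⊙ x = 1` as a function of the other coordinates `y`,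
when `K_i = ±1`; it is `0` when `K_i = 0`. -/
noncomputable def graphRadicand {n : ℕ} (k : Fin n → ℝ) (i : Fin (n + 1)) (y : Fin n → ℝ) : ℝ :=
  charProd k i * (1 - ∑ j, charProd k (i.succAbove j) * y j * y j)

theorem contDiff_graphRadicand {n : ℕ} (k : Fin n → ℝ) (i : Fin (n + 1)) :
    ContDiff ℝ 1 (graphRadicand k i) := by
  unfold graphRadicand
  fun_prop

/-- The hypersurface `x ⊙ x = 1` as a graph over the coordinates other than `x_i`, where `ε` is the
sign of `x_i`. -/
noncomputable def graphParam {n : ℕ} (k : Fin n → ℝ) (i : Fin (n + 1)) (ε : ℤˣ) (y : Fin n → ℝ) :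
    Fin (n + 1) → ℝ :=
  i.insertNth ((ε : ℤ) * √(graphRadicand k i y)) y

theorem intUnits_cast_mul_self (ε : ℤˣ) : ((ε : ℤ) : ℝ) * (ε : ℤ) = 1 := by
  rw [← Int.cast_mul, ← Units.val_mul, Int.units_mul_self, Units.val_one, Int.cast_one]

theorem contDiffAt_graphParam {n : ℕ} (k : Fin n → ℝ) (i : Fin (n + 1)) (ε : ℤˣ)
    {y : Fin n → ℝ} (hy : 0 < graphRadicand k i y) :
    ContDiffAt ℝ 1 (graphParam k i ε) y := by
  refine contDiffAt_pi.2 fun l => ?_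
  cases l using i.succAboveCases with
  | x =>
    simp only [graphParam, Fin.insertNth_apply_same]
    exact contDiffAt_const.mul ((contDiff_graphRadicand k i).contDiffAt.sqrt hy.ne')
  | p j =>
    simp only [graphParam, Fin.insertNth_apply_succAbove]
    fun_prop

/-- The part of the hypersurface where `K_i ≠ 0` and `x_i` has the sign `ε`, as a patch. If `K_i = 0`,
its domain is empty. It is an immersion because forgetting `x_i` is a linear left inverse. -/
noncomputable def graphPatch {n : ℕ} {k : Fin n → ℝ} (hk : ∀ i, k i = -1 ∨ k i = 0 ∨ k i = 1)
    (i : Fin (n + 1)) (ε : ℤˣ) : NativePatch k where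
  param := graphParam k i ε
  U := {y | 0 < graphRadicand k i y}
  isOpen_U := isOpen_lt continuous_const (contDiff_graphRadicand k i).continuous
  contDiffOn y hy := (contDiffAt_graphParam k i ε hy).contDiffWithinAt
  injOn y _ z _ h := by
    have := congrArg i.removeNth h
    simpa [graphParam] using this
  immersion y hy := by
    let R : (Fin (n + 1) → ℝ) →L[ℝ] (Fin n → ℝ) :=
      ContinuousLinearMap.pi fun j => ContinuousLinearMap.proj (i.succAbove j)
    have h := ((contDiffAt_graphParam k i ε hy).differentiableAt one_ne_zero).hasFDerivAt
    have h1 : HasFDerivAt (R ∘ graphParam k i ε) _ y := R.hasFDerivAt.comp y h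
    have h2 : R ∘ graphParam k i ε = id := by
      funext z j
      simp [R, graphParam]
    rw [h2] at h1
    have h3 := h1.unique (hasFDerivAt_id y)
    exact Function.LeftInverse.injective (g := R) fun v =>
      congrArg (fun f : (Fin n → ℝ) →L[ℝ] (Fin n → ℝ) => f v) h3
  mapsTo y hy := by
    have hy' : 0 < graphRadicand k i y := hy
    have hi : charProd k i ≠ 0 := by
      intro h
      simp [graphRadicand, h] at hy'
    have h1 := charProd_mul_self hk hi
    have h2 := Real.mul_self_sqrt hy'.le
    have h3 := intUnits_cast_mul_self ε
    change charDot k _ _ = 1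
    rw [charDot, Fin.sum_univ_succAbove _ i]
    simp only [graphParam, Fin.insertNth_apply_same, Fin.insertNth_apply_succAbove]
    have h4 : charProd k i * graphRadicand k i y =
        1 - ∑ j, charProd k (i.succAbove j) * y j * y j := by
      rw [graphRadicand, ← mul_assoc, h1, one_mul]
    linear_combination charProd k i * (√(graphRadicand k i y) * √(graphRadicand k i y)) * h3 +
      charProd k i * h2 + h4
  A := {y | 0 < graphRadicand k i y}
  measurableSet_A :=
    (isOpen_lt continuous_const (contDiff_graphRadicand k i).continuous).measurableSet
  subset_U := le_rfl

theorem mem_image_graphPatch {n : ℕ} {k : Fin n → ℝ} (hk : ∀ i, k i = -1 ∨ k i = 0 ∨ k i = 1)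
    {x : Fin (n + 1) → ℝ} (hx : x ∈ unitVectors k) {i : Fin (n + 1)} (hi : charProd k i ≠ 0)
    {ε : ℤˣ} (hε : 0 < (ε : ℤ) * x i) : x ∈ (graphPatch hk i ε).image := by
  have hx' : charDot k x x = 1 := hx
  have h3 := intUnits_cast_mul_self ε
  have hrad : graphRadicand k i (i.removeNth x) = ((ε : ℤ) * x i) ^ 2 := by
    rw [charDot, Fin.sum_univ_succAbove _ i] at hx'
    simp only [graphRadicand, Fin.removeNth]
    linear_combination -charProd k i * hx' + x i * x i * charProd_mul_self hk hi - x i * x i * h3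
  refine ⟨i.removeNth x, ?_, ?_⟩
  · change 0 < graphRadicand k i (i.removeNth x)
    rw [hrad]
    positivity
  · change i.insertNth ((ε : ℤ) * √(graphRadicand k i (i.removeNth x))) (i.removeNth x) = x
    rw [hrad, Real.sqrt_sq hε.le, ← mul_assoc, h3, one_mul, Fin.insertNth_self_removeNth]

theorem exists_mem_image_graphPatch {n : ℕ} {k : Fin n → ℝ}
    (hk : ∀ i, k i = -1 ∨ k i = 0 ∨ k i = 1) {x : Fin (n + 1) → ℝ} (hx : x ∈ unitVectors k) :
    ∃ i ε, x ∈ (graphPatch hk i ε).image := by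
  have hx' : charDot k x x = 1 := hx
  obtain ⟨i, -, hi⟩ := Finset.exists_ne_zero_of_sum_ne_zero (hx'.trans_ne one_ne_zero)
  have hxi : x i ≠ 0 := right_ne_zero_of_mul hi
  have hKi : charProd k i ≠ 0 := left_ne_zero_of_mul (left_ne_zero_of_mul hi)
  rcases hxi.lt_or_gt with h | h
  · exact ⟨i, -1, mem_image_graphPatch hk hx hKi (by simpa using h)⟩
  · exact ⟨i, 1, mem_image_graphPatch hk hx hKi (by simpa using h)⟩

/-- A Borel subset of the hypersurface is the disjoint union of countably many patches. -/
theorem exists_patch_partition {n : ℕ} {k : Fin n → ℝ} (hk : ∀ i, k i = -1 ∨ k i = 0 ∨ k i = 1)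
    {F : Set (Fin (n + 1) → ℝ)} (hFk : F ⊆ unitVectors k) (hF : MeasurableSet F) :
    ∃ P : ℕ → NativePatch k, Pairwise (Function.onFun Disjoint fun m => (P m).image) ∧
      ⋃ m, (P m).image = F := by
  obtain ⟨e, he⟩ := exists_surjective_nat (Fin (n + 1) × ℤˣ)
  let S : ℕ → Set (Fin (n + 1) → ℝ) := fun m => (graphPatch hk (e m).1 (e m).2).image
  have hS : ∀ m, MeasurableSet (disjointed S m ∩ F) := fun m =>
    (MeasurableSet.disjointed (fun m => NativePatch.measurableSet_image _) m).inter hF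
  let P : ℕ → NativePatch k := fun m => (graphPatch hk (e m).1 (e m).2).restrict _ (hS m)
  have hP : ∀ m, (P m).image = disjointed S m ∩ F := by
    intro m
    rw [NativePatch.image_restrict]
    exact Set.inter_eq_right.2 (Set.inter_subset_left.trans (disjointed_subset S m))
  refine ⟨P, fun a b hab => ?_, ?_⟩
  · simp only [Function.onFun, hP]
    exact (disjoint_disjointed S hab).mono Set.inter_subset_left Set.inter_subset_left
  · simp only [hP]
    rw [← Set.iUnion_inter, iUnion_disjointed, Set.inter_eq_right]
    intro x hx
    obtain ⟨i, ε, h⟩ := exists_mem_image_graphPatch hk (hFk hx)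
    obtain ⟨m, hm⟩ := he (i, ε)
    refine Set.mem_iUnion.2 ⟨m, ?_⟩
    simpa only [S, hm] using h

/-! ### Native volume and cone measure -/

theorem nativeVolumeVec_eq {n : ℕ} {k : Fin n → ℝ} (hk : ∀ i, k i = -1 ∨ k i = 0 ∨ k i = 1)
    {F : Set (Fin (n + 1) → ℝ)} (hFk : F ⊆ unitVectors k) (hF : MeasurableSet F) :
    nativeVolumeVec k F = ((n : ℝ≥0∞) + 1) * coneMeasure k F := by
  refine le_antisymm ?_ (le_iInf₂ fun P hP => ?_)
  · obtain ⟨P, hdisj, hU⟩ := exists_patch_partition hk hFk hF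
    refine (iInf₂_le P hU.ge).trans_eq ?_
    simp only [NativePatch.vol_eq hk]
    rw [ENNReal.tsum_mul_left,
      ← MeasureTheory.measure_iUnion hdisj fun m => (P m).measurableSet_image, hU]
  · simp only [NativePatch.vol_eq hk]
    rw [ENNReal.tsum_mul_left]
    gcongr
    exact (MeasureTheory.measure_mono hP).trans (MeasureTheory.measure_iUnion_le _)

theorem eq_or_eq_neg_of_mem_submodule {n : ℕ} {k : Fin n → ℝ} {p : ℙ ℝ (Fin (n + 1) → ℝ)}
    {x y : Fin (n + 1) → ℝ} (hx : x ∈ unitVectors k) (hy : y ∈ unitVectors k)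
    (hxp : x ∈ p.submodule) (hyp : y ∈ p.submodule) : y = x ∨ y = -x := by
  have hx' : charDot k x x = 1 := hx
  have hy' : charDot k y y = 1 := hy
  rw [Projectivization.submodule_eq, Submodule.mem_span_singleton] at hxp hyp
  obtain ⟨a, rfl⟩ := hxp
  obtain ⟨b, rfl⟩ := hyp
  rw [charDot_smul_smul] at hx' hy'
  have hv : charDot k p.rep p.rep ≠ 0 := right_ne_zero_of_mul (hx'.trans_ne one_ne_zero)
  rcases sq_eq_sq_iff_eq_or_eq_neg.1 (mul_right_cancel₀ hv (hy'.trans hx'.symm)) with h | h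
  · exact Or.inl (by rw [h])
  · exact Or.inr (by rw [h, neg_smul])

/-- As `F` contains only one of the two representatives of a point, it is disjoint from `-F`. -/
theorem Represents.disjoint_neg {n : ℕ} {k : Fin n → ℝ} {F : Set (Fin (n + 1) → ℝ)}
    {G : Set (ℙ ℝ (Fin (n + 1) → ℝ))} (h : Represents k F G) : Disjoint F (-F) := by
  refine Set.disjoint_left.2 fun x hx hx' => ?_
  obtain ⟨p, hp, hxp⟩ := h.2.1 x hx
  have h1 : x = -x := (h.2.2 p hp).unique ⟨hx, hxp⟩ ⟨hx', p.submodule.neg_mem hxp⟩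
  have h2 : charDot k x x = 1 := h.1 hx
  rw [self_eq_neg.1 h1] at h2
  simp [charDot] at h2

/-- A patch `S` covers projectively the part of `F` in `S ∪ -S`. This part has no more cone measure
than `S`: reflecting the piece in `-S` gives a subset of `S` disjoint from the other piece. -/
theorem coneMeasure_inter_union_neg_le {n : ℕ} (k : Fin n → ℝ) {F S : Set (Fin (n + 1) → ℝ)}
    (hF : MeasurableSet F) (hS : MeasurableSet S) (hdisj : Disjoint F (-F)) :
    coneMeasure k (F ∩ (S ∪ -S)) ≤ coneMeasure k S := by
  have hneg : F ∩ -S = -(-F ∩ S) := by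
    rw [Set.inter_neg, neg_neg]
  calc coneMeasure k (F ∩ (S ∪ -S))
      ≤ coneMeasure k (F ∩ S) + coneMeasure k (F ∩ -S) := by
        rw [Set.inter_union_distrib_left]
        exact MeasureTheory.measure_union_le _ _
    _ = coneMeasure k (F ∩ S) + coneMeasure k (-F ∩ S) := by
        rw [hneg, coneMeasure_neg k (hF.neg.inter hS)]
    _ = coneMeasure k (F ∩ S ∪ -F ∩ S) :=
        (MeasureTheory.measure_union
          (hdisj.mono Set.inter_subset_left Set.inter_subset_left) (hF.neg.inter hS)).symm
    _ ≤ coneMeasure k S :=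
        MeasureTheory.measure_mono (Set.union_subset Set.inter_subset_right Set.inter_subset_right)

theorem nativeVolume_eq {n : ℕ} {k : Fin n → ℝ} (hk : ∀ i, k i = -1 ∨ k i = 0 ∨ k i = 1)
    {F : Set (Fin (n + 1) → ℝ)} {G : Set (ℙ ℝ (Fin (n + 1) → ℝ))} (hF : MeasurableSet F)
    (h : Represents k F G) : nativeVolume k G = ((n : ℝ≥0∞) + 1) * coneMeasure k F := by
  refine le_antisymm ?_ (le_iInf₂ fun P hP => ?_)
  · rw [← nativeVolumeVec_eq hk h.1 hF]
    refine le_iInf₂ fun P hP => iInf₂_le P fun p hp => ?_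
    obtain ⟨x, hx, hxp⟩ := (h.2.2 p hp).exists
    obtain ⟨i, hi⟩ := Set.mem_iUnion.1 (hP hx)
    exact ⟨i, x, hi, hxp⟩
  · have hcover : F ⊆ ⋃ i, F ∩ ((P i).image ∪ -(P i).image) := by
      intro x hx
      obtain ⟨p, hp, hxp⟩ := h.2.1 x hx
      obtain ⟨i, y, hy, hyp⟩ := hP p hp
      refine Set.mem_iUnion.2 ⟨i, hx, ?_⟩
      rcases eq_or_eq_neg_of_mem_submodule ((P i).image_subset hy) (h.1 hx) hyp hxp with rfl | rfl
      · exact Or.inl hy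
      · exact Or.inr (by simpa using hy)
    simp only [NativePatch.vol_eq hk]
    rw [ENNReal.tsum_mul_left]
    gcongr
    exact (MeasureTheory.measure_mono hcover).trans
      ((MeasureTheory.measure_iUnion_le _).trans (ENNReal.tsum_le_tsum fun i =>
        coneMeasure_inter_union_neg_le k hF (P i).measurableSet_image h.disjoint_neg))

theorem mainTheorem5 (n : ℕ) (k : Fin n → ℝ) (hk : ∀ i, k i = -1 ∨ k i = 0 ∨ k i = 1) :
    (∀ F : Set (Fin (n + 1) → ℝ), F ⊆ unitVectors k → MeasurableSet F →
      MeasureTheory.volume (coneOver F) = 1 / ((n : ℝ≥0∞) + 1) * nativeVolumeVec k F) ∧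
    (∀ G : Set (ℙ ℝ (Fin (n + 1) → ℝ)), G ⊆ unitBall k →
      ∀ F : Set (Fin (n + 1) → ℝ), MeasurableSet F → Represents k F G →
        MeasureTheory.volume (coneOver F) = 1 / ((n : ℝ≥0∞) + 1) * nativeVolume k G) := by
  have hn : 1 / ((n : ℝ≥0∞) + 1) * ((n : ℝ≥0∞) + 1) = 1 := by
    rw [one_div, ENNReal.inv_mul_cancel (by simp) (by finiteness)]
  refine ⟨fun F hFk hF => ?_, fun G _ F hF h => ?_⟩
  · rw [volume_coneOver hFk hF, nativeVolumeVec_eq hk hFk hF, ← mul_assoc, hn, one_mul]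
  · rw [volume_coneOver h.1 hF, nativeVolume_eq hk hF h, ← mul_assoc, hn, one_mul]
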